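/- Let $p$ be a prime, let $K$ be a field of characteristic $p$, let $\delta\colon K\to K$ be a derivation, and let $F=\mathrm{Const}(\delta)=\{a\in K : \delta(a)=0\}$. Let $K[t;\delta]$ be the differential polynomial ring, i.e. the ring of polynomials $\sum_i a_it^i$ ($a_i\in K$) with termwise addition and the multiplication determined by $ta=at+\delta(a)$ for $a\in K$. Assume that $\delta$, as an $F$-linear endomorphism of $K$, has minimal polynomial $g(t)=t^p-t\in F[t]$. Let $d\in K\setminus F$ and $f(t)=t^p-t-d\in K[t;\delta]$. Let $(K,\delta,d)=K[t;\delta]/K[t;\delta]f$ be the set $\{h\in K[t;\delta] : \deg h<p\}$ with the addition of $K[t;\delta]$ and the multiplication $h\circ k = hk \bmod_r f$, where $hk\bmod_r f$ is the remainder $r$ of right division by $f$, that is, the unique $r$ with $\deg r<p$ and $hk=qf+r$ for some $q\in K[t;\delta]$. The elements of $K$ are viewed in $(K,\delta,d)$ as the constant polynomials. Then $A=(K,\delta,d)$ is a unital algebra over $F$ that is not associative, it has dimension $p^2$ over $F$, and it is a division algebra: $A\neq 0$ and for every nonzero $a\in A$ the maps $x\mapsto ax$ and $x\mapsto xa$ are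 bijective. With $[x,y,z]=(xy)z-x(yz)$, its left nucleus $\{x : [x,A,A]=0\}$ and its middle nucleus $\{x : [A,x,A]=0\}$ are both equal to $K$, and its right nucleus $\{x : [A,A,x]=0\}$ contains $K$. The group of $F$-algebra automorphisms of $A$ has a cyclic subgroup of order $p$ all of whose elements fix every element of $K$. -/

import Mathlib

open Polynomial

universe u

noncomputable section

/-- The field of constants `Const(δ) = {a ∈ K | δ(a) = 0}` of a derivation `δ` of a field `K`. -/
def derivConst {K : Type u} [Field K] (δ : Derivation ℤ K K) : Subfield K where
  carrier := {a | δ a = 0}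
  mul_mem' {a b} ha hb := by
    simp only [Set.mem_ofPred_eq] at ha hb ⊢
    simp [ha, hb]
  one_mem' := δ.map_one_eq_zero
  add_mem' {a b} ha hb := by
    simp only [Set.mem_ofPred_eq] at ha hb ⊢
    simp [ha, hb]
  zero_mem' := map_zero δ
  neg_mem' {a} ha := by
    simp only [Set.mem_ofPred_eq] at ha ⊢
    simp [ha]
  inv_mem' a ha := by
    simp only [Set.mem_ofPred_eq] at ha ⊢
    simp [Derivation.leibniz_inv, ha]

/-- A derivation `δ` of `K`, regarded as a linear endomorphism of `K` over its constants. -/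
def derivEnd {K : Type u} [Field K] (δ : Derivation ℤ K K) :
    Module.End (derivConst δ) K where
  toFun := δ
  map_add' := map_add δ
  map_smul' c a := by
    have hc : δ (c : K) = 0 := c.2
    simp [Subfield.smul_def, hc]

/-! ### Differential polynomial rings -/

/-- The differential polynomial ring `K[t;δ]`. Its elements are the polynomials `∑ aᵢ tⁱ` with
coefficients on the left; the product is the one determined by `t a = a t + δ(a)`. -/
def DiffPoly {K : Type u} [Field K] (_δ : Derivation ℤ K K) : Type u := K[X]

namespace DiffPoly

variable {K : Type u} [Field K] (δ : Derivation ℤ K K)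

instance : AddCommGroup (DiffPoly δ) := inferInstanceAs (AddCommGroup K[X])

instance : Module K (DiffPoly δ) := inferInstanceAs (Module K K[X])

/-- `∑ aᵢ tⁱ ↦ ∑ δ(aᵢ) tⁱ`. -/
def coeffDeriv : K[X] →+ K[X] where
  toFun g := ∑ i ∈ g.support, monomial i (δ (g.coeff i))
  map_zero' := by simp
  map_add' f g := by
    have key : ∀ g : K[X], ∀ n,
        (∑ i ∈ g.support, monomial i (δ (g.coeff i))).coeff n = δ (g.coeff n) := by
      intro g n
      simp only [finsetSum_coeff, coeff_monomial, Finset.sum_ite_eq']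
      split_ifs with h
      · rfl
      · rw [notMem_support_iff.mp h, map_zero]
    ext n
    rw [coeff_add, key, key, key, coeff_add, map_add]

theorem coeff_coeffDeriv (g : K[X]) (n : ℕ) :
    (coeffDeriv δ g).coeff n = δ (g.coeff n) := by
  simp only [coeffDeriv, AddMonoidHom.coe_mk, ZeroHom.coe_mk, finsetSum_coeff, coeff_monomial,
    Finset.sum_ite_eq']
  split_ifs with h
  · rfl
  · rw [notMem_support_iff.mp h, map_zero]

/-- Left multiplication by `t` in `K[t;δ]`: `t (∑ aᵢ tⁱ) = ∑ aᵢ tⁱ⁺¹ + ∑ δ(aᵢ) tⁱ`. -/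
def tMul : Module.End ℤ K[X] :=
  (AddMonoidHom.mulLeft (X : K[X]) + coeffDeriv δ).toIntLinearMap

theorem tMul_apply (g : K[X]) : tMul δ g = X * g + coeffDeriv δ g := rfl

/-- The product of `K[t;δ]`: `(∑ aᵢ tⁱ) g = ∑ aᵢ (t (t ⋯ (t g)))`, with `i` factors `t`. -/
def mulAux (f g : K[X]) : K[X] := f.sum fun i a => C a * (tMul δ ^ i) g

theorem mulAux_add_left (f₁ f₂ g : K[X]) :
    mulAux δ (f₁ + f₂) g = mulAux δ f₁ g + mulAux δ f₂ g := by
  unfold mulAux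
  exact sum_add_index _ _ _ (by simp) (by intros; simp [add_mul])

theorem mulAux_add_right (f g₁ g₂ : K[X]) :
    mulAux δ f (g₁ + g₂) = mulAux δ f g₁ + mulAux δ f g₂ := by
  simp [mulAux, Polynomial.sum_def, mul_add, Finset.sum_add_distrib]

theorem mulAux_monomial (n : ℕ) (a : K) (g : K[X]) :
    mulAux δ (monomial n a) g = C a * (tMul δ ^ n) g := by
  simp [mulAux, sum_monomial_index]

theorem mulAux_C_mul (a : K) (f g : K[X]) :
    mulAux δ (C a * f) g = C a * mulAux δ f g := by
  induction f using Polynomial.induction_on' with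
  | add p q hp hq => rw [mul_add, mulAux_add_left, hp, hq, mulAux_add_left, mul_add]
  | monomial n b => rw [C_mul_monomial, mulAux_monomial, mulAux_monomial, C_mul, mul_assoc]

theorem tMul_C_mul (a : K) (g : K[X]) :
    tMul δ (C a * g) = C a * tMul δ g + C (δ a) * g := by
  have h : coeffDeriv δ (C a * g) = C a * coeffDeriv δ g + C (δ a) * g := by
    ext n
    simp only [coeff_coeffDeriv, coeff_C_mul, coeff_add, Derivation.leibniz, smul_eq_mul]
    ring
  rw [tMul_apply, tMul_apply, h]
  ring

theorem mulAux_tMul (f g : K[X]) : mulAux δ (tMul δ f) g = tMul δ (mulAux δ f g) := by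
  induction f using Polynomial.induction_on' with
  | add p q hp hq => rw [map_add, mulAux_add_left, hp, hq, mulAux_add_left, map_add]
  | monomial n b =>
    have h : tMul δ (monomial n b) = monomial (n + 1) b + monomial n (δ b) := by
      rw [tMul_apply, X_mul_monomial]
      congr 1
      ext m
      rw [coeff_coeffDeriv, coeff_monomial, coeff_monomial]
      split_ifs <;> simp
    rw [h, mulAux_add_left, mulAux_monomial, mulAux_monomial, mulAux_monomial, tMul_C_mul,
      pow_succ', Module.End.mul_apply]

theorem mulAux_tMul_pow (n : ℕ) (f g : K[X]) :
    mulAux δ ((tMul δ ^ n) f) g = (tMul δ ^ n) (mulAux δ f g) := by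
  induction n with
  | zero => simp
  | succ n ih => rw [pow_succ', Module.End.mul_apply, mulAux_tMul, ih, Module.End.mul_apply]

theorem mulAux_assoc (f g h : K[X]) :
    mulAux δ (mulAux δ f g) h = mulAux δ f (mulAux δ g h) := by
  induction f using Polynomial.induction_on' with
  | add p q hp hq => simp only [mulAux_add_left, hp, hq]
  | monomial n b => rw [mulAux_monomial, mulAux_monomial, mulAux_C_mul, mulAux_tMul_pow]

theorem mulAux_one_left (g : K[X]) : mulAux δ 1 g = g := by
  rw [← monomial_zero_one, mulAux_monomial]
  simp

theorem tMul_X_pow (n : ℕ) : tMul δ (X ^ n) = X ^ (n + 1) := by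
  rw [tMul_apply, pow_succ']
  have : coeffDeriv δ (X ^ n) = 0 := by
    ext m
    rw [coeff_coeffDeriv, coeff_X_pow]
    split_ifs <;> simp
  rw [this, add_zero]

theorem tMul_pow_one (n : ℕ) : (tMul δ ^ n) 1 = X ^ n := by
  induction n with
  | zero => simp
  | succ n ih => rw [pow_succ', Module.End.mul_apply, ih, tMul_X_pow]

theorem mulAux_one_right (f : K[X]) : mulAux δ f 1 = f := by
  induction f using Polynomial.induction_on' with
  | add p q hp hq => rw [mulAux_add_left, hp, hq]
  | monomial n b => rw [mulAux_monomial, tMul_pow_one, C_mul_X_pow_eq_monomial]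

theorem mulAux_zero_left (g : K[X]) : mulAux δ 0 g = 0 := by simp [mulAux]

theorem mulAux_zero_right (f : K[X]) : mulAux δ f 0 = 0 := by
  simp [mulAux, Polynomial.sum_def]

instance : Ring (DiffPoly δ) :=
  { (inferInstance : AddCommGroup (DiffPoly δ)) with
    mul := mulAux δ
    one := (1 : K[X])
    left_distrib := mulAux_add_right δ
    right_distrib := mulAux_add_left δ
    zero_mul := mulAux_zero_left δ
    mul_zero := mulAux_zero_right δ
    mul_assoc := mulAux_assoc δ
    one_mul := mulAux_one_left δ
    mul_one := mulAux_one_right δ }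

variable {δ}

/-- The underlying polynomial `∑ aᵢ Xⁱ` of `∑ aᵢ tⁱ`. -/
def toPoly : DiffPoly δ ≃ₗ[K] K[X] := LinearEquiv.refl K K[X]

theorem toPoly_mul (f g : DiffPoly δ) : toPoly (f * g) = mulAux δ (toPoly f) (toPoly g) := rfl

theorem toPoly_one : toPoly (1 : DiffPoly δ) = 1 := rfl

/-- The degree of a differential polynomial (with the value `0` at `0`). -/
def natDegree (f : DiffPoly δ) : ℕ := (toPoly f).natDegree

variable (δ)

/-- The indeterminate `t` of `K[t;δ]`. -/
def t : DiffPoly δ := toPoly.symm X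

/-- The constant polynomial `a` in `K[t;δ]`. -/
def const (a : K) : DiffPoly δ := toPoly.symm (C a)

/-- The defining relation `t a = a t + δ(a)` of `K[t;δ]`. -/
theorem t_mul_const (a : K) : t δ * const δ a = const δ a * t δ + const δ (δ a) := by
  apply toPoly.injective
  rw [map_add, toPoly_mul, toPoly_mul]
  simp only [t, const, LinearEquiv.apply_symm_apply]
  rw [← monomial_zero_left (a := a), mulAux_monomial, ← monomial_one_one_eq_X, mulAux_monomial]
  rw [monomial_zero_left, pow_one, ← mul_one (C a), tMul_C_mul, ← pow_zero X, tMul_X_pow]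
  simp [monomial_one_one_eq_X]

/-- A differential polynomial is the sum of the terms `aᵢ tⁱ`. -/
theorem eq_sum (f : DiffPoly δ) :
    f = ∑ i ∈ (toPoly f).support, const δ ((toPoly f).coeff i) * t δ ^ i := by
  have ht : ∀ n : ℕ, toPoly (t δ ^ n) = X ^ n := by
    intro n
    induction n with
    | zero => rfl
    | succ n ih =>
      rw [pow_succ', toPoly_mul, ih, t, LinearEquiv.apply_symm_apply, ← monomial_one_one_eq_X,
        mulAux_monomial, monomial_one_one_eq_X, pow_one, tMul_X_pow, C_1, one_mul]
  apply toPoly.injective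
  rw [map_sum]
  conv_lhs => rw [(toPoly f).as_sum_support_C_mul_X_pow]
  refine Finset.sum_congr rfl fun i _ => ?_
  rw [toPoly_mul, ht, const, LinearEquiv.apply_symm_apply, ← monomial_zero_left, mulAux_monomial]
  simp

theorem smul_eq_const_mul (a : K) (f : DiffPoly δ) : a • f = const δ a * f := by
  apply toPoly.injective
  rw [map_smul, toPoly_mul, const, LinearEquiv.apply_symm_apply, ← monomial_zero_left,
    mulAux_monomial, smul_eq_C_mul]
  simp

/-! ### Right division with remainder -/

theorem degree_tMul_sub_lt (n : ℕ) (g : K[X]) (hg : g ≠ 0) :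
    ((tMul δ ^ n) g - X ^ n * g).degree < n + g.degree := by
  have hd : ∀ h : K[X], (coeffDeriv δ h).degree ≤ h.degree := by
    intro h
    rw [degree_le_iff_coeff_zero]
    intro m hm
    rw [coeff_coeffDeriv, coeff_eq_zero_of_degree_lt hm, map_zero]
  have hb : g.degree ≠ ⊥ := fun h => hg (degree_eq_bot.mp h)
  obtain ⟨k, hk⟩ : ∃ k : ℕ, g.degree = k := ⟨_, degree_eq_natDegree hg⟩
  induction n with
  | zero =>
    simp [hk]
  | succ n ih =>
    have e : (tMul δ ^ (n + 1)) g - X ^ (n + 1) * g =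
        X * ((tMul δ ^ n) g - X ^ n * g) + coeffDeriv δ ((tMul δ ^ n) g) := by
      rw [pow_succ', Module.End.mul_apply, tMul_apply]
      ring
    rw [e]
    have h2 : ((tMul δ ^ n) g).degree ≤ n + g.degree := by
      have : (tMul δ ^ n) g = ((tMul δ ^ n) g - X ^ n * g) + X ^ n * g := by ring
      rw [this]
      refine (degree_add_le _ _).trans (max_le ih.le ?_)
      rw [degree_mul, degree_X_pow]
    have h3 : ((n : WithBot ℕ) + g.degree) < ((n + 1 : ℕ) : WithBot ℕ) + g.degree := by
      rw [hk]
      norm_cast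
      omega
    refine (degree_add_le _ _).trans_lt (max_lt ?_ (((hd _).trans h2).trans_lt h3))
    rw [degree_mul, degree_X]
    by_cases h0 : (tMul δ ^ n) g - X ^ n * g = 0
    · rw [h0, degree_zero, WithBot.add_bot, hk]
      exact WithBot.bot_lt_coe _
    · rw [degree_eq_natDegree h0, hk] at ih ⊢
      norm_cast at ih ⊢
      omega

theorem degree_mulAux_sub_lt (f g : K[X]) (hf : f ≠ 0) (hg : g ≠ 0) :
    (mulAux δ f g - f * g).degree < (f * g).degree := by
  have e : mulAux δ f g - f * g =
      ∑ i ∈ f.support, C (f.coeff i) * ((tMul δ ^ i) g - X ^ i * g) := by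
    conv_lhs => rw [mulAux, Polynomial.sum_def]
    conv_lhs => enter [2, 1]; rw [f.as_sum_support_C_mul_X_pow]
    rw [Finset.sum_mul, ← Finset.sum_sub_distrib]
    exact Finset.sum_congr rfl fun i _ => by ring
  have hfg : (⊥ : WithBot ℕ) < (f * g).degree := bot_lt_iff_ne_bot.mpr fun h =>
    mul_ne_zero hf hg (degree_eq_bot.mp h)
  rw [e]
  refine (degree_sum_le _ _).trans_lt ((Finset.sup_lt_iff hfg).mpr fun i hi => ?_)
  rw [degree_C_mul (mem_support_iff.mp hi)]
  refine (degree_tMul_sub_lt δ i g hg).trans_le ?_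
  rw [degree_mul]
  gcongr
  exact le_degree_of_mem_supp _ hi

theorem degree_mulAux (f g : K[X]) : (mulAux δ f g).degree = f.degree + g.degree := by
  by_cases hf : f = 0
  · simp [hf, mulAux]
  by_cases hg : g = 0
  · simp [hg, mulAux, Polynomial.sum_def]
  have : mulAux δ f g = f * g + (mulAux δ f g - f * g) := by ring
  rw [this, degree_add_eq_left_of_degree_lt (degree_mulAux_sub_lt δ f g hf hg), degree_mul]

/-- The left `K`-space of differential polynomials of degree less than `m`. -/
def degLT (m : ℕ) : Submodule K (DiffPoly δ) :=
  (degreeLT K m).comap (toPoly : DiffPoly δ ≃ₗ[K] K[X]).toLinearMap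

variable {δ}

theorem mem_degLT {m : ℕ} {g : DiffPoly δ} : g ∈ degLT δ m ↔ (toPoly g).degree < m := by
  simp [degLT, mem_degreeLT]

/-- Existence in the right division algorithm: `g = q f + r` with `deg r < deg f`. -/
theorem exists_rem (f : DiffPoly δ) (hf : f ≠ 0) (g : DiffPoly δ) :
    ∃ r : degLT δ (natDegree f), ∃ q : DiffPoly δ, g = q * f + r := by
  have hf' : toPoly f ≠ 0 := fun h => hf (toPoly.map_eq_zero_iff.mp h)
  have main : ∀ n : ℕ, ∀ g : DiffPoly δ, (toPoly g).degree < n →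
      ∃ r : degLT δ (natDegree f), ∃ q : DiffPoly δ, g = q * f + r := by
    intro n
    induction n with
    | zero =>
      intro g hg
      refine ⟨⟨g, mem_degLT.mpr (hg.trans_le ?_)⟩, 0, by simp⟩
      exact_mod_cast Nat.zero_le _
    | succ n ih =>
      intro g hg
      by_cases hlt : (toPoly g).degree < (natDegree f : ℕ)
      · exact ⟨⟨g, mem_degLT.mpr hlt⟩, 0, by simp⟩
      have hg' : toPoly g ≠ 0 := by
        intro h
        rw [h, degree_zero] at hlt
        exact hlt (WithBot.bot_lt_coe _)
      have hle : (toPoly f).natDegree ≤ (toPoly g).natDegree := by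
        rw [degree_eq_natDegree hg'] at hlt
        exact not_lt.mp (by exact_mod_cast hlt)
      set a := (toPoly g).leadingCoeff / (toPoly f).leadingCoeff with ha
      have ha0 : a ≠ 0 := div_ne_zero (leadingCoeff_ne_zero.mpr hg')
        (leadingCoeff_ne_zero.mpr hf')
      set q : K[X] := C a * X ^ ((toPoly g).natDegree - (toPoly f).natDegree) with hq
      have hq0 : q ≠ 0 := mul_ne_zero (C_ne_zero.mpr ha0) (pow_ne_zero _ X_ne_zero)
      have hdeg : (q * toPoly f).degree = (toPoly g).degree := by
        rw [degree_mul, hq, degree_C_mul_X_pow _ ha0, degree_eq_natDegree hf',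
          degree_eq_natDegree hg']
        norm_cast
        omega
      have hlc : (toPoly g).leadingCoeff = (q * toPoly f).leadingCoeff := by
        rw [leadingCoeff_mul, hq, leadingCoeff_C_mul_X_pow, ha,
          div_mul_cancel₀ _ (leadingCoeff_ne_zero.mpr hf')]
      have h1 : (toPoly g - q * toPoly f).degree < (toPoly g).degree :=
        degree_sub_lt_left hdeg.symm hg' hlc
      have h2 := degree_mulAux_sub_lt δ q (toPoly f) hq0 hf'
      rw [hdeg] at h2
      have h3 : (toPoly (g - toPoly.symm q * f)).degree < n := by
        have e : toPoly (g - toPoly.symm q * f) =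
            (toPoly g - q * toPoly f) - (mulAux δ q (toPoly f) - q * toPoly f) := by
          rw [map_sub, toPoly_mul, LinearEquiv.apply_symm_apply]
          ring
        have h4 : (toPoly (g - toPoly.symm q * f)).degree < (toPoly g).degree := by
          rw [e]
          exact (degree_sub_le _ _).trans_lt (max_lt h1 h2)
        refine h4.trans_le ?_
        rw [degree_eq_natDegree hg'] at hg ⊢
        norm_cast at hg ⊢
        omega
      obtain ⟨r, q', h⟩ := ih _ h3
      refine ⟨r, toPoly.symm q + q', ?_⟩
      rw [add_mul, add_assoc, ← h]
      abel
  exact main ((toPoly g).natDegree + 1) g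
    (degree_le_natDegree.trans_lt (by exact_mod_cast Nat.lt_succ_self _))

/-- Uniqueness of the remainder in the right division algorithm. -/
theorem rem_unique {f g q q' : DiffPoly δ} {r r' : degLT δ (natDegree f)} (hf : f ≠ 0)
    (h : g = q * f + r) (h' : g = q' * f + r') : r = r' := by
  have hf' : toPoly f ≠ 0 := fun h => hf (toPoly.map_eq_zero_iff.mp h)
  have e : (q' - q) * f = ((r - r' : degLT δ (natDegree f)) : DiffPoly δ) := by
    have := h.symm.trans h'
    rw [sub_mul, Submodule.coe_sub, sub_eq_sub_iff_add_eq_add, ← this]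
    abel
  have hlt := mem_degLT.mp (r - r').2
  rw [← e, toPoly_mul, degree_mulAux, degree_eq_natDegree hf'] at hlt
  have hq : toPoly (q' - q) = 0 := by
    by_contra h0
    rw [degree_eq_natDegree h0] at hlt
    norm_cast at hlt
    unfold natDegree at hlt
    omega
  have hq0 : q' - q = 0 := toPoly.map_eq_zero_iff.mp hq
  rw [hq0, zero_mul] at e
  exact sub_eq_zero.mp (Subtype.ext e.symm)

open Classical in
/-- The remainder `g mod_r f` of the right division `g = q f + r`, `deg r < deg f`
(and `0` if `f = 0`). -/
def modr (f g : DiffPoly δ) : degLT δ (natDegree f) :=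
  if hf : f ≠ 0 then (exists_rem f hf g).choose else 0

theorem modr_spec (f g : DiffPoly δ) (hf : f ≠ 0) : ∃ q, g = q * f + modr f g := by
  rw [modr, dif_pos hf]
  exact (exists_rem f hf g).choose_spec

theorem modr_add (f g h : DiffPoly δ) : modr f (g + h) = modr f g + modr f h := by
  by_cases hf : f = 0
  · simp [modr, hf]
  obtain ⟨q₁, h₁⟩ := modr_spec f g hf
  obtain ⟨q₂, h₂⟩ := modr_spec f h hf
  obtain ⟨q₃, h₃⟩ := modr_spec f (g + h) hf
  refine rem_unique hf h₃ (q' := q₁ + q₂) ?_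
  rw [Submodule.coe_add, add_mul]
  nth_rewrite 1 [h₁, h₂]
  abel

theorem modr_smul (f : DiffPoly δ) (a : K) (g : DiffPoly δ) :
    modr f (a • g) = a • modr f g := by
  by_cases hf : f = 0
  · simp [modr, hf]
  obtain ⟨q₁, h₁⟩ := modr_spec f g hf
  obtain ⟨q₂, h₂⟩ := modr_spec f (a • g) hf
  refine rem_unique hf h₂ (q' := a • q₁) ?_
  rw [Submodule.coe_smul, smul_eq_const_mul, smul_eq_const_mul, smul_eq_const_mul, mul_assoc,
    ← mul_add, ← h₁]

theorem modr_coe (f : DiffPoly δ) (r : degLT δ (natDegree f)) : modr f (r : DiffPoly δ) = r := by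
  by_cases hf : f = 0
  · subst hf
    have h0 : ∀ s : degLT δ (natDegree (0 : DiffPoly δ)), s = 0 := by
      intro s
      have hz : ((natDegree (0 : DiffPoly δ) : ℕ) : WithBot ℕ) = 0 := by simp [natDegree]
      have hs := (mem_degLT.mp s.2).trans_eq hz
      rw [Nat.WithBot.lt_zero_iff, degree_eq_bot] at hs
      exact Subtype.ext (toPoly.map_eq_zero_iff.mp hs)
    rw [h0 r, h0 (modr _ _)]
  obtain ⟨q, h⟩ := modr_spec f r hf
  exact rem_unique hf h (q' := 0) (by simp)

end DiffPoly

/-! ### Petit algebras -/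

/-- The Petit algebra `S_f = K[t;δ]/K[t;δ]f`: the differential polynomials of degree less than
`deg f`, with the multiplication `g ∘ h = g h mod_r f`. -/
def PetitAlgebra {K : Type u} [Field K] {δ : Derivation ℤ K K} (f : DiffPoly δ) : Type u :=
  DiffPoly.degLT δ f.natDegree

namespace PetitAlgebra

open DiffPoly

variable {K : Type u} [Field K] {δ : Derivation ℤ K K} (f : DiffPoly δ)

instance : AddCommGroup (PetitAlgebra f) :=
  inferInstanceAs (AddCommGroup (degLT δ (DiffPoly.natDegree f)))

/-- `S_f` is a left `K`-space, by multiplication in `K[t;δ]`; by restriction of scalars it is a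
vector space over every subfield of `K`. -/
instance : Module K (PetitAlgebra f) :=
  inferInstanceAs (Module K (degLT δ (DiffPoly.natDegree f)))

variable {f}

/-- The representative of degree less than `deg f`. -/
def rep : PetitAlgebra f →ₗ[K] DiffPoly δ := (degLT δ (DiffPoly.natDegree f)).subtype

variable (f)

/-- The remainder modulo `f`, as an element of `S_f`. -/
def mk : DiffPoly δ →ₗ[K] PetitAlgebra f where
  toFun g := modr f g
  map_add' := modr_add f
  map_smul' := modr_smul f

variable {f}

theorem mk_rep (x : PetitAlgebra f) : mk f (rep x) = x := modr_coe f x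

theorem rep_mk_one_or (f : DiffPoly δ) :
    rep (mk f 1) = 1 ∨ ∀ x : PetitAlgebra f, x = 0 := by
  by_cases h : DiffPoly.natDegree f = 0
  · right
    intro x
    have hz : ((DiffPoly.natDegree f : ℕ) : WithBot ℕ) = 0 := by simp [h]
    have hx := (mem_degLT.mp x.2).trans_eq hz
    rw [Nat.WithBot.lt_zero_iff, degree_eq_bot] at hx
    exact Subtype.ext (toPoly.map_eq_zero_iff.mp hx)
  · left
    have h1 : (1 : DiffPoly δ) ∈ degLT δ (DiffPoly.natDegree f) := by
      rw [mem_degLT, toPoly_one, degree_one]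
      exact_mod_cast Nat.pos_of_ne_zero h
    exact congrArg Subtype.val (modr_coe f ⟨1, h1⟩)

instance : NonAssocRing (PetitAlgebra f) :=
  { (inferInstance : AddCommGroup (PetitAlgebra f)) with
    mul := fun x y => mk f (rep x * rep y)
    one := mk f 1
    left_distrib := fun x y z => by
      change mk f (rep x * rep (y + z)) = mk f (rep x * rep y) + mk f (rep x * rep z)
      rw [map_add, mul_add, map_add]
    right_distrib := fun x y z => by
      change mk f (rep (x + y) * rep z) = mk f (rep x * rep z) + mk f (rep y * rep z)
      rw [map_add, add_mul, map_add]
    zero_mul := fun x => by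
      change mk f (rep 0 * rep x) = 0
      rw [map_zero, zero_mul, map_zero]
    mul_zero := fun x => by
      change mk f (rep x * rep 0) = 0
      rw [map_zero, mul_zero, map_zero]
    one_mul := fun x => by
      change mk f (rep (mk f 1) * rep x) = x
      rcases rep_mk_one_or f with h | h
      · rw [h, one_mul, mk_rep]
      · rw [h x, h (mk f _)]
    mul_one := fun x => by
      change mk f (rep x * rep (mk f 1)) = x
      rcases rep_mk_one_or f with h | h
      · rw [h, mul_one, mk_rep]
      · rw [h x, h (mk f _)] }

variable (f)

/-- The map sending `a ∈ K` to the constant polynomial `a` in `S_f`; its range is the copy of `K`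
contained in `S_f`. -/
def ofField : K →+* PetitAlgebra f where
  toFun a := mk f (const δ a)
  map_one' := rfl
  map_mul' a b := by
    change _ = mk f (rep _ * rep _)
    have h : ∀ c : K, mk f (const δ c) = c • mk f 1 := by
      intro c
      rw [← map_smul, smul_eq_const_mul, mul_one]
    rcases rep_mk_one_or f with h1 | h1
    · simp only [h, map_smul, h1]
      rw [smul_eq_const_mul δ a 1, mul_one, ← smul_eq_const_mul, map_smul, map_smul, mul_smul]
    · rw [h1 (mk f _), h1 (mk f (_ * _))]
  map_zero' := by
    have : const δ (0 : K) = 0 := by simp [const]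
    rw [this, map_zero]
  map_add' a b := by
    have : const δ (a + b) = const δ a + const δ b := by simp [const]
    rw [this, map_add]

end PetitAlgebra

/-! ### Nonassociative algebras -/

/-- The left nucleus of a nonassociative ring. -/
def leftNucleus (A : Type u) [NonAssocRing A] : Set A :=
  {x | ∀ y z : A, (x * y) * z - x * (y * z) = 0}

/-- The middle nucleus of a nonassociative ring. -/
def middleNucleus (A : Type u) [NonAssocRing A] : Set A :=
  {x | ∀ y z : A, (y * x) * z - y * (x * z) = 0}

/-- The right nucleus of a nonassociative ring. -/
def rightNucleus (A : Type u) [NonAssocRing A] : Set A :=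
  {x | ∀ y z : A, (y * z) * x - y * (z * x) = 0}

/-- A nonassociative ring is a division ring if it is nonzero and all left and right
multiplications by nonzero elements are bijective. -/
def IsNonassocDivision (A : Type u) [NonAssocRing A] : Prop :=
  Nontrivial A ∧ ∀ a : A, a ≠ 0 →
    Function.Bijective (fun x : A => a * x) ∧ Function.Bijective (fun x : A => x * a)

/-- The group of `F`-algebra automorphisms of a nonassociative `F`-algebra `A`: the multiplicative
`F`-linear bijections. -/
def nonassocAut (F A : Type u) [Field F] [NonAssocRing A] [Module F A] :
    Subgroup (A ≃ₗ[F] A) where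
  carrier := {φ | ∀ x y : A, φ (x * y) = φ x * φ y}
  mul_mem' {φ ψ} hφ hψ x y := by
    change φ (ψ (x * y)) = φ (ψ x) * φ (ψ y)
    rw [hψ, hφ]
  one_mem' x y := rfl
  inv_mem' {φ} hφ x y := by
    change φ.symm (x * y) = φ.symm x * φ.symm y
    apply φ.injective
    rw [hφ]
    simp

end

/-! Since `δ ^ p = δ`, the element `c = t ^ p - t` is central in `R = K[t;δ]`, and `f = c - d`.

The left ideal `Rf` is maximal. Indeed, a left ideal `I` containing `f` is stable under right
multiplication by `d`, because `v d = c v - v f`; so it is stable under the commutator with `d`,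
which lowers the degree by exactly one as long as the degree is nonzero modulo `p`. Hence a nonzero
`w ∈ I` of degree less than `p` can be lowered to a nonzero constant. If now `x y = 0` in `S_f` with
`x` and `y` nonzero, then `y` generates the simple module `R / Rf` and is annihilated by `x`, so
`deg f = dim_K (R / Rf) ≤ deg x`, which is absurd.

If `x y = q f + r` in `R` with `r` reduced, then `[x, y, z] = - q f z` modulo `Rf`. This vanishes
if `q = 0`, and also if `f` commutes with `z`, as it does for `z ∈ K`. For `z = t` it equals
`- q δ(d)`, so it vanishes only if `q = 0`; the choice `{x, y} ∋ t ^ (p - 1)` then forces the other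
factor to be constant.

By `δ ^ p = δ`, `K` is the direct sum of the `p` eigenspaces of `δ` for the elements of `𝔽_p`, each
of which is a line over `F`: some eigenvector `e` has eigenvalue `1`, and its powers span these
lines.
The automorphisms come from `t ↦ t + 1`, which fixes `f`.
-/

section Eigenspaces

theorem biSup_eigenspace_eq_ker_aeval_prod {F V ι : Type*} [Field F] [AddCommGroup V] [Module F V]
    (φ : Module.End F V) {μ : ι → F} {s : Finset ι} (hμ : Set.InjOn μ s) :
    ⨆ i ∈ s, φ.eigenspace (μ i) = LinearMap.ker (aeval φ (∏ i ∈ s, (X - C (μ i)))) := by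
  classical
  induction s using Finset.induction_on with
  | empty => simp [Module.End.one_eq_id]
  | insert i s his ih =>
    have hcoprime : IsCoprime (X - C (μ i)) (∏ j ∈ s, (X - C (μ j))) :=
      IsCoprime.prod_right fun j hj => isCoprime_X_sub_C_of_isUnit_sub <| IsUnit.mk0 _ <|
        sub_ne_zero.mpr fun h => his <|
          hμ (Finset.mem_insert_self i s) (Finset.mem_insert_of_mem hj) h ▸ hj
    rw [Finset.iSup_insert, Finset.prod_insert his,
      ih (hμ.mono (Finset.coe_subset.mpr (Finset.subset_insert i s))),
      ← sup_ker_aeval_eq_ker_aeval_mul_of_coprime φ hcoprime, Module.End.eigenspace_def]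
    simp [Algebra.algebraMap_eq_smul_one]

variable {F : Type*} [Field F] (p : ℕ) [Fact p.Prime] [CharP F p]

theorem X_pow_char_sub_X_eq_prod :
    (X ^ p - X : F[X]) = ∏ i : ZMod p, (X - C (ZMod.castHom dvd_rfl F i)) := by
  have hp : 1 < p := (Fact.out : p.Prime).one_lt
  have hroots : (X ^ p - X : (ZMod p)[X]).roots = Finset.univ.val := by
    simpa only [ZMod.card] using FiniteField.roots_X_pow_card_sub_X (ZMod p)
  have hprod := prod_multiset_X_sub_C_of_monic_of_roots_card_eq
    (monic_X_pow_sub (p := (X : (ZMod p)[X])) (by simpa using hp))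
    (by rw [hroots, FiniteField.X_pow_card_sub_X_natDegree_eq (ZMod p) hp, Finset.card_val,
      Finset.card_univ, ZMod.card])
  rw [hroots] at hprod
  have hmap := congrArg (map (ZMod.castHom dvd_rfl F)) hprod.symm
  simpa only [Polynomial.map_sub, Polynomial.map_pow, map_X, Finset.prod_map_val,
    Polynomial.map_prod, map_C] using hmap

theorem iSup_eigenspace_eq_top_of_pow_char_eq_self {V : Type*} [AddCommGroup V] [Module F V]
    {φ : Module.End F V} (hφ : φ ^ p = φ) :
    ⨆ i : ZMod p, φ.eigenspace (ZMod.castHom dvd_rfl F i) = ⊤ := by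
  have hker := biSup_eigenspace_eq_ker_aeval_prod φ (s := Finset.univ)
    (ZMod.castHom dvd_rfl F).injective.injOn
  rw [← X_pow_char_sub_X_eq_prod, map_sub, map_pow, aeval_X, hφ, sub_self, LinearMap.ker_zero]
    at hker
  simpa only [Finset.mem_univ, iSup_pos] using hker

end Eigenspaces

theorem mem_derivConst {K : Type u} [Field K] {δ : Derivation ℤ K K} {a : K} :
    a ∈ derivConst δ ↔ δ a = 0 := Iff.rfl

theorem derivEnd_apply {K : Type u} [Field K] (δ : Derivation ℤ K K) (a : K) :
    derivEnd δ a = δ a := rfl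

namespace derivEnd

variable {K : Type u} [Field K] {δ : Derivation ℤ K K}

theorem mem_eigenspace_iff {x : K} {μ : derivConst δ} :
    x ∈ (derivEnd δ).eigenspace μ ↔ δ x = μ * x := by
  rw [Module.End.mem_eigenspace_iff, derivEnd_apply, Subfield.smul_def, smul_eq_mul]

theorem pow_mem_eigenspace {x : K} {μ : derivConst δ} (hx : x ∈ (derivEnd δ).eigenspace μ)
    (n : ℕ) : x ^ n ∈ (derivEnd δ).eigenspace (n * μ) := by
  rw [mem_eigenspace_iff] at hx ⊢
  cases n with
  | zero => simp
  | succ n =>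
    simp only [Derivation.leibniz_pow, hx, Nat.add_sub_cancel, nsmul_eq_mul, smul_eq_mul]
    push_cast
    ring

theorem eigenspace_eq_span_singleton {x : K} {μ : derivConst δ}
    (hx : x ∈ (derivEnd δ).eigenspace μ) (hx0 : x ≠ 0) :
    (derivEnd δ).eigenspace μ = Submodule.span (derivConst δ) {x} := by
  refine le_antisymm (fun y hy => ?_) ((Submodule.span_singleton_le_iff_mem _ _).mpr hx)
  rw [mem_eigenspace_iff] at hx hy
  have hconst : δ (y / x) = 0 := by
    rw [Derivation.leibniz_div, hx, hy]
    simp only [smul_eq_mul]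
    ring
  exact Submodule.mem_span_singleton.mpr ⟨⟨y / x, hconst⟩, div_mul_cancel₀ y hx0⟩

variable (p : ℕ) [Fact p.Prime] [CharP K p]

theorem exists_ne_zero_mem_eigenspace_one (hδ : derivEnd δ ^ p = derivEnd δ) {d : K}
    (hd : δ d ≠ 0) : ∃ x ≠ 0, x ∈ (derivEnd δ).eigenspace 1 := by
  let μ : ZMod p →+* derivConst δ := ZMod.castHom dvd_rfl (derivConst δ)
  obtain ⟨i, hi⟩ : ∃ i, ¬ (derivEnd δ).eigenspace (μ i) ≤ LinearMap.ker (derivEnd δ) := by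
    by_contra! hall
    have hker := (iSup_eigenspace_eq_top_of_pow_char_eq_self p hδ).ge.trans (iSup_le hall)
    exact hd (hker (Submodule.mem_top (x := d)))
  obtain ⟨y, hy, hδy⟩ := SetLike.not_le_iff_exists.mp hi
  have hδy' : μ i * y ≠ 0 := mem_eigenspace_iff.mp hy ▸ hδy
  have hi0 : i ≠ 0 := by
    rintro rfl
    simp only [map_zero, ZeroMemClass.coe_zero, zero_mul, ne_eq, not_true_eq_false] at hδy'
  refine ⟨y ^ (i⁻¹).val, pow_ne_zero _ (right_ne_zero_of_mul hδy'), ?_⟩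
  have hpow := pow_mem_eigenspace hy (i⁻¹).val
  rwa [← map_natCast μ, ← map_mul, ZMod.natCast_zmod_val, inv_mul_cancel₀ hi0, map_one] at hpow

theorem finrank_derivConst (hδ : derivEnd δ ^ p = derivEnd δ) {d : K} (hd : δ d ≠ 0) :
    Module.finrank (derivConst δ) K = p := by
  obtain ⟨x, hx0, hx⟩ := exists_ne_zero_mem_eigenspace_one p hδ hd
  let μ : ZMod p → derivConst δ := ZMod.castHom dvd_rfl (derivConst δ)
  have hmem (i : ZMod p) : x ^ i.val ∈ (derivEnd δ).eigenspace (μ i) := by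
    simpa [μ] using pow_mem_eigenspace hx i.val
  have hindep : LinearIndependent (derivConst δ) fun i : ZMod p => x ^ i.val :=
    Module.End.eigenvectors_linearIndependent' (derivEnd δ) μ (ZMod.castHom _ _).injective _
      fun i => ⟨hmem i, pow_ne_zero _ hx0⟩
  have hspan : Submodule.span (derivConst δ) (Set.range fun i : ZMod p => x ^ i.val) = ⊤ := by
    rw [Submodule.span_range_eq_iSup, ← iSup_eigenspace_eq_top_of_pow_char_eq_self p hδ]
    exact iSup_congr fun i => (eigenspace_eq_span_singleton (hmem i) (pow_ne_zero _ hx0)).symm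
  rw [Module.finrank_eq_card_basis (.mk hindep hspan.ge), ZMod.card]

end derivEnd

namespace DiffPoly

section Basic

variable {K : Type u} [Field K] {δ : Derivation ℤ K K}

instance : Nontrivial (DiffPoly δ) := inferInstanceAs (Nontrivial K[X])

theorem toPoly_const (a : K) : toPoly (const δ a) = C a := rfl

theorem toPoly_t : toPoly (t δ) = X := rfl

theorem toPoly_eq_zero {u : DiffPoly δ} : toPoly u = 0 ↔ u = 0 := toPoly.map_eq_zero_iff

theorem toPoly_const_mul (a : K) (u : DiffPoly δ) : toPoly (const δ a * u) = C a * toPoly u := by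
  rw [← smul_eq_const_mul, map_smul, smul_eq_C_mul]

theorem toPoly_t_mul (u : DiffPoly δ) :
    toPoly (t δ * u) = X * toPoly u + coeffDeriv δ (toPoly u) := by
  rw [toPoly_mul, toPoly_t, ← monomial_one_one_eq_X, mulAux_monomial, C_1, one_mul, pow_one,
    tMul_apply, monomial_one_one_eq_X]

theorem toPoly_t_pow (n : ℕ) : toPoly (t δ ^ n) = X ^ n := by
  induction n with
  | zero => rfl
  | succ n ih => rw [pow_succ', toPoly_t_mul, ih, ← tMul_apply, tMul_X_pow]

variable (δ) in
/-- The embedding `a ↦ a` of `K` in `K[t;δ]`, as a ring homomorphism. -/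
noncomputable def constHom : K →+* DiffPoly δ where
  toFun := const δ
  map_one' := rfl
  map_mul' a b := toPoly.injective <| by rw [toPoly_const_mul, toPoly_const, toPoly_const, C_mul]
  map_zero' := toPoly.injective <| by rw [toPoly_const, C_0, map_zero]
  map_add' a b := toPoly.injective <| by rw [map_add, toPoly_const, C_add]; rfl

theorem constHom_apply (a : K) : constHom δ a = const δ a := rfl

theorem const_zero : const δ (0 : K) = 0 := (constHom δ).map_zero

theorem const_one : const δ (1 : K) = 1 := rfl

theorem const_add (a b : K) : const δ (a + b) = const δ a + const δ b := (constHom δ).map_add a b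

theorem const_mul (a b : K) : const δ (a * b) = const δ a * const δ b := (constHom δ).map_mul a b

theorem const_eq_zero {a : K} : const δ a = 0 ↔ a = 0 := map_eq_zero (constHom δ)

theorem commute_const_const (a b : K) : Commute (const δ a) (const δ b) :=
  (Commute.all a b).map (constHom δ)

instance (p : ℕ) [CharP K p] : CharP (DiffPoly δ) p :=
  charP_of_injective_ringHom (constHom δ).injective p

instance : IsScalarTower K (DiffPoly δ) (DiffPoly δ) where
  smul_assoc a u v := by simp only [smul_eq_const_mul, smul_eq_mul, mul_assoc]

theorem degree_toPoly_mul (u v : DiffPoly δ) :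
    (toPoly (u * v)).degree = (toPoly u).degree + (toPoly v).degree := by
  rw [toPoly_mul, degree_mulAux]

instance : NoZeroDivisors (DiffPoly δ) where
  eq_zero_or_eq_zero_of_mul_eq_zero {u v} h := by
    have hdeg := degree_toPoly_mul u v
    rwa [h, map_zero, degree_zero, eq_comm, WithBot.add_eq_bot, degree_eq_bot, degree_eq_bot,
      toPoly_eq_zero, toPoly_eq_zero] at hdeg

theorem degree_toPoly {u : DiffPoly δ} (hu : u ≠ 0) : (toPoly u).degree = natDegree u :=
  degree_eq_natDegree fun h => hu (toPoly_eq_zero.mp h)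

theorem natDegree_lt_of_mem_degLT {m : ℕ} {u : DiffPoly δ} (hu : u ∈ degLT δ m) (hu0 : u ≠ 0) :
    natDegree u < m := by
  rw [mem_degLT, degree_toPoly hu0] at hu
  exact_mod_cast hu

theorem ne_zero_of_natDegree_pos {u : DiffPoly δ} (hu : 0 < natDegree u) : u ≠ 0 := by
  rintro rfl
  simp [natDegree] at hu

theorem natDegree_mul {u v : DiffPoly δ} (hu : u ≠ 0) (hv : v ≠ 0) :
    natDegree (u * v) = natDegree u + natDegree v := by
  have hdeg := degree_toPoly_mul u v
  rw [degree_toPoly (mul_ne_zero hu hv), degree_toPoly hu, degree_toPoly hv] at hdeg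
  exact_mod_cast hdeg

theorem degLT_mono {m n : ℕ} (h : m ≤ n) : degLT δ m ≤ degLT δ n := fun u hu => by
  rw [mem_degLT] at hu ⊢
  exact hu.trans_le (by exact_mod_cast h)

theorem const_mem_degLT {m : ℕ} (hm : 0 < m) (a : K) : const δ a ∈ degLT δ m := by
  rw [mem_degLT, toPoly_const]
  exact degree_C_le.trans_lt (by exact_mod_cast hm)

theorem exists_const_eq_of_mem_degLT_one {u : DiffPoly δ} (hu : u ∈ degLT δ 1) :
    ∃ a, const δ a = u := by
  rw [mem_degLT, Nat.cast_one, Nat.WithBot.lt_one_iff_le_zero] at hu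
  exact ⟨_, toPoly.injective (eq_C_of_degree_le_zero hu).symm⟩

theorem t_pow_mem_degLT_iff {m n : ℕ} : t δ ^ n ∈ degLT δ m ↔ n < m := by
  rw [mem_degLT, toPoly_t_pow, degree_X_pow, Nat.cast_lt]

theorem mul_mem_degLT {m n : ℕ} {u v : DiffPoly δ} (hu : u ∈ degLT δ m) (hv : v ∈ degLT δ n) :
    u * v ∈ degLT δ (m + n) := by
  rw [mem_degLT] at hu hv ⊢
  rw [degree_toPoly_mul, Nat.cast_add]
  exact (add_le_add_right hv.le _).trans_lt
    (WithBot.add_lt_add_right (WithBot.natCast_ne_bot n) hu)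

theorem mul_mem_degLT_comm {m : ℕ} {u v : DiffPoly δ} :
    u * v ∈ degLT δ m ↔ v * u ∈ degLT δ m := by
  rw [mem_degLT, mem_degLT, degree_toPoly_mul, degree_toPoly_mul, add_comm]

theorem mul_mem_degLT_add_natDegree_iff {m : ℕ} {u v : DiffPoly δ} (hv : v ≠ 0) :
    u * v ∈ degLT δ (m + natDegree v) ↔ u ∈ degLT δ m := by
  rw [mem_degLT, mem_degLT, degree_toPoly_mul, degree_toPoly hv, Nat.cast_add]
  exact WithBot.add_lt_add_iff_right (WithBot.natCast_ne_bot _)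

theorem mul_const_mem_degLT {m : ℕ} {u : DiffPoly δ} (hu : u ∈ degLT δ m) (a : K) :
    u * const δ a ∈ degLT δ m := by
  rw [mul_mem_degLT_comm, ← smul_eq_const_mul]
  exact Submodule.smul_mem _ a hu

theorem isMaximal_span_singleton {f : DiffPoly δ} (hf : 0 < natDegree f)
    (h : ∀ I : Ideal (DiffPoly δ), f ∈ I → ∀ w ∈ I, w ≠ 0 → natDegree w < natDegree f → I = ⊤) :
    (Ideal.span {f}).IsMaximal := by
  have hf0 := ne_zero_of_natDegree_pos hf
  refine Ideal.isMaximal_iff.mpr ⟨fun h1 => ?_, fun J x hJ hx hxJ => ?_⟩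
  · obtain ⟨a, ha⟩ := Ideal.mem_span_singleton'.mp h1
    have ha0 : a ≠ 0 := left_ne_zero_of_mul (ha ▸ one_ne_zero)
    have hnat : natDegree a + natDegree f = 0 := by
      rw [← natDegree_mul ha0 hf0, ha, natDegree, toPoly_one, natDegree_one]
    omega
  · have hfJ : f ∈ J := hJ (Ideal.mem_span_singleton_self f)
    obtain ⟨r, q, rfl⟩ := exists_rem f hf0 x
    have hqf : q * f ∈ Ideal.span {f} := Ideal.mul_mem_left _ q (Ideal.mem_span_singleton_self f)
    have hr0 : (r : DiffPoly δ) ≠ 0 := fun h0 => hx (by rwa [h0, add_zero])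
    have hrJ : (r : DiffPoly δ) ∈ J := (J.add_mem_iff_right (hJ hqf)).mp hxJ
    exact (Ideal.eq_top_iff_one J).mp (h J hfJ r hrJ hr0 (natDegree_lt_of_mem_degLT r.2 hr0))

theorem commute_of_commute_const_of_commute_t {v : DiffPoly δ}
    (hconst : ∀ a, Commute v (const δ a)) (ht : Commute v (t δ)) (u : DiffPoly δ) :
    Commute v u := by
  rw [eq_sum δ u]
  exact Commute.sum_right _ _ _ fun i _ => (hconst _).mul_right (ht.pow_right i)

theorem commute_const_of_mem_derivConst {a : K} (ha : a ∈ derivConst δ) (u : DiffPoly δ) :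
    Commute (const δ a) u := by
  refine commute_of_commute_const_of_commute_t (commute_const_const a) (Commute.symm ?_) u
  rw [commute_iff_eq, t_mul_const, mem_derivConst.mp ha, const_zero, add_zero]

theorem coeff_t_pow_mul_const (n m : ℕ) (a : K) :
    (toPoly (t δ ^ n * const δ a)).coeff m = n.choose m * (derivEnd δ ^ (n - m)) a := by
  induction n generalizing m with
  | zero => cases m <;> simp [toPoly_const, coeff_C]
  | succ n ih =>
    rw [pow_succ', mul_assoc, toPoly_t_mul, coeff_add, coeff_coeffDeriv, ih, Derivation.leibniz,
      Derivation.map_natCast, smul_zero, add_zero, smul_eq_mul, ← derivEnd_apply,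
      ← Module.End.mul_apply, ← pow_succ']
    cases m with
    | zero => simp
    | succ m =>
      rw [coeff_X_mul, ih, Nat.choose_succ_succ, Nat.add_sub_add_right]
      rcases le_or_gt (m + 1) n with hm | hm
      · rw [show n - (m + 1) + 1 = n - m by omega]
        push_cast
        ring
      · simp [Nat.choose_eq_zero_of_lt hm]

theorem t_pow_char_mul_const (p : ℕ) [Fact p.Prime] [CharP K p] (a : K) :
    t δ ^ p * const δ a = const δ a * t δ ^ p + const δ ((derivEnd δ ^ p) a) := by
  have hp : p.Prime := Fact.out
  apply toPoly.injective
  ext m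
  rw [coeff_t_pow_mul_const, map_add, toPoly_const_mul, toPoly_t_pow, toPoly_const, coeff_add,
    coeff_C_mul_X_pow, coeff_C]
  rcases Nat.eq_zero_or_pos m with rfl | hm
  · simp [hp.ne_zero.symm]
  rcases lt_trichotomy m p with h | rfl | h
  · have hchoose : (p.choose m : K) = 0 :=
      (CharP.cast_eq_zero_iff K p _).mpr (hp.dvd_choose_self hm.ne' h)
    simp [hchoose, hm.ne', h.ne]
  · simp [hm.ne']
  · simp [Nat.choose_eq_zero_of_lt h, hm.ne', h.ne']

end Basic

section Lift

variable {K : Type u} [Field K] {δ : Derivation ℤ K K} {B : Type*} [Semiring B]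

theorem ringHom_ext {φ ψ : DiffPoly δ →+* B} (hconst : ∀ a, φ (const δ a) = ψ (const δ a))
    (ht : φ (t δ) = ψ (t δ)) : φ = ψ := by
  ext u
  rw [eq_sum δ u]
  simp only [map_sum, map_mul, map_pow, hconst, ht]

variable (φ : K →+* B) (τ : B)

theorem eval₂_C_mul (a : K) (g : K[X]) : (C a * g).eval₂ φ τ = φ a * g.eval₂ φ τ := by
  induction g using Polynomial.induction_on' with
  | add g h hg hh => rw [mul_add, eval₂_add, hg, hh, eval₂_add, mul_add]
  | monomial n b => rw [C_mul_monomial, eval₂_monomial, eval₂_monomial, map_mul, mul_assoc]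

variable {φ τ}

theorem eval₂_tMul (h : ∀ a, τ * φ a = φ a * τ + φ (δ a)) (g : K[X]) :
    (tMul δ g).eval₂ φ τ = τ * g.eval₂ φ τ := by
  induction g using Polynomial.induction_on' with
  | add g g' hg hg' => rw [map_add, eval₂_add, hg, hg', eval₂_add, mul_add]
  | monomial n a =>
    rw [← C_mul_X_pow_eq_monomial, tMul_C_mul, tMul_X_pow, eval₂_add, eval₂_C_mul, eval₂_C_mul,
      eval₂_C_mul, eval₂_X_pow, eval₂_X_pow, ← mul_assoc τ, h, add_mul, pow_succ', mul_assoc]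

theorem eval₂_tMul_pow (h : ∀ a, τ * φ a = φ a * τ + φ (δ a)) (n : ℕ) (g : K[X]) :
    ((tMul δ ^ n) g).eval₂ φ τ = τ ^ n * g.eval₂ φ τ := by
  induction n with
  | zero => simp
  | succ n ih => rw [pow_succ', Module.End.mul_apply, eval₂_tMul h, ih, pow_succ', mul_assoc]

theorem eval₂_mulAux (h : ∀ a, τ * φ a = φ a * τ + φ (δ a)) (f g : K[X]) :
    (mulAux δ f g).eval₂ φ τ = f.eval₂ φ τ * g.eval₂ φ τ := by
  induction f using Polynomial.induction_on' with
  | add f f' hf hf' => rw [mulAux_add_left, eval₂_add, hf, hf', eval₂_add, add_mul]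
  | monomial n a =>
    rw [mulAux_monomial, eval₂_C_mul, eval₂_tMul_pow h, eval₂_monomial, mul_assoc]

variable (φ τ) in
/-- The universal property of `K[t;δ]`: a ring homomorphism `φ` on `K` extends to `K[t;δ]` by
`t ↦ τ` as soon as `τ` satisfies the defining relation `τ φ(a) = φ(a) τ + φ(δ(a))`. -/
noncomputable def lift (h : ∀ a, τ * φ a = φ a * τ + φ (δ a)) : DiffPoly δ →+* B where
  toFun u := (toPoly u).eval₂ φ τ
  map_one' := eval₂_one φ τ
  map_zero' := eval₂_zero φ τ
  map_add' u v := by rw [map_add, eval₂_add]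
  map_mul' u v := eval₂_mulAux h (toPoly u) (toPoly v)

theorem lift_const (h : ∀ a, τ * φ a = φ a * τ + φ (δ a)) (a : K) :
    lift φ τ h (const δ a) = φ a := eval₂_C φ τ

theorem lift_t (h : ∀ a, τ * φ a = φ a * τ + φ (δ a)) : lift φ τ h (t δ) = τ := eval₂_X φ τ

end Lift

section Shift

variable {K : Type u} [Field K] {δ : Derivation ℤ K K}

variable (δ) in
/-- The substitution `t ↦ t + c`, a ring endomorphism of `K[t;δ]` for every `c ∈ K` since `c`
commutes with `K`. -/
noncomputable def shift (c : K) : DiffPoly δ →+* DiffPoly δ :=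
  lift (constHom δ) (t δ + const δ c) fun a => by
    simp only [constHom_apply, add_mul, mul_add, t_mul_const, (commute_const_const c a).eq]
    abel

theorem shift_const (c a : K) : shift δ c (const δ a) = const δ a := lift_const _ a

theorem shift_t (c : K) : shift δ c (t δ) = t δ + const δ c := lift_t _

theorem shift_smul (c a : K) (u : DiffPoly δ) : shift δ c (a • u) = a • shift δ c u := by
  rw [smul_eq_const_mul, map_mul, shift_const, ← smul_eq_const_mul]

theorem shift_shift (b c : K) (u : DiffPoly δ) : shift δ b (shift δ c u) = shift δ (b + c) u := by
  have hcomp : (shift δ b).comp (shift δ c) = shift δ (b + c) :=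
    ringHom_ext (fun a => by simp only [RingHom.comp_apply, shift_const])
      (by simp only [RingHom.comp_apply, map_add, shift_t, shift_const, const_add, add_assoc])
  exact RingHom.congr_fun hcomp u

theorem shift_zero (u : DiffPoly δ) : shift δ 0 u = u := by
  have hid : shift δ 0 = RingHom.id (DiffPoly δ) :=
    ringHom_ext (shift_const 0) (by rw [shift_t, const_zero, add_zero, RingHom.id_apply])
  exact RingHom.congr_fun hid u

theorem degree_toPoly_t_add_const_pow (c : K) (n : ℕ) :
    (toPoly ((t δ + const δ c) ^ n)).degree = n := by
  induction n with
  | zero => rw [pow_zero, toPoly_one, degree_one, Nat.cast_zero]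
  | succ n ih =>
    rw [pow_succ, degree_toPoly_mul, ih, map_add, toPoly_t, toPoly_const, degree_X_add_C,
      Nat.cast_succ]

theorem shift_mem_degLT (c : K) {m : ℕ} {u : DiffPoly δ} (hu : u ∈ degLT δ m) :
    shift δ c u ∈ degLT δ m := by
  rw [eq_sum δ u, map_sum]
  refine Submodule.sum_mem _ fun i hi => ?_
  rw [map_mul, map_pow, shift_const, shift_t, ← smul_eq_const_mul]
  refine Submodule.smul_mem _ _ (mem_degLT.mpr ?_)
  rw [degree_toPoly_t_add_const_pow]
  exact (le_degree_of_mem_supp i hi).trans_lt (mem_degLT.mp hu)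

end Shift

section Commutator

variable {K : Type u} [Field K] {δ : Derivation ℤ K K} {c : K}

theorem coeff_commutator_const (w : DiffPoly δ) (c : K) (m : ℕ) :
    (toPoly (w * const δ c - const δ c * w)).coeff m = ∑ i ∈ Finset.Ioc m (natDegree w),
      (toPoly w).coeff i * (i.choose m * (derivEnd δ ^ (i - m)) c) := by
  let term (i : ℕ) : K := (toPoly w).coeff i * (i.choose m * (derivEnd δ ^ (i - m)) c)
  have hmul : (toPoly (w * const δ c)).coeff m = ∑ i ∈ (toPoly w).support, term i := by
    conv_lhs => rw [eq_sum δ w, Finset.sum_mul, map_sum, finsetSum_coeff]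
    simp only [term, mul_assoc, toPoly_const_mul, coeff_C_mul, coeff_t_pow_mul_const]
  have hterm_of_lt (i : ℕ) (hi : i < m) : term i = 0 := by
    simp [term, Nat.choose_eq_zero_of_lt hi]
  have hsum : ∑ i ∈ (toPoly w).support, term i =
      ∑ i ∈ insert m (Finset.Ioc m (natDegree w)), term i := by
    refine Finset.sum_congr_of_eq_on_inter (fun i hi hi' => hterm_of_lt i ?_)
      (fun i _ hi => by simp [term, notMem_support_iff.mp hi]) fun _ _ _ => rfl
    have hle : i ≤ natDegree w := le_natDegree_of_mem_supp i hi
    simp only [Finset.mem_insert, Finset.mem_Ioc] at hi'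
    omega
  rw [map_sub, coeff_sub, hmul, hsum, Finset.sum_insert (by simp), toPoly_const_mul, coeff_C_mul]
  simp [term, mul_comm c]

theorem degree_toPoly_commutator_const (hc : δ c ≠ 0) {w : DiffPoly δ} {k : ℕ}
    (hw : (toPoly w).degree = (k + 1 : ℕ)) (hk : ((k + 1 : ℕ) : K) ≠ 0) :
    (toPoly (w * const δ c - const δ c * w)).degree = k := by
  have hnat : natDegree w = k + 1 := natDegree_eq_of_degree_eq_some hw
  refine degree_eq_of_le_of_coeff_ne_zero (degree_le_iff_coeff_zero _ _ |>.mpr fun m hm => ?_) ?_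
  · rw [coeff_commutator_const, hnat, Finset.Ioc_eq_empty_of_le, Finset.sum_empty]
    exact_mod_cast hm
  · rw [coeff_commutator_const, hnat, Nat.Ioc_succ_singleton, Finset.sum_singleton,
      Nat.choose_succ_self_right, Nat.add_sub_cancel_left, pow_one, derivEnd_apply]
    exact mul_ne_zero (coeff_ne_zero_of_eq_degree hw) (mul_ne_zero hk hc)

theorem eq_top_of_forall_mul_const_mem (hc : δ c ≠ 0) {I : Ideal (DiffPoly δ)}
    (hI : ∀ v ∈ I, v * const δ c ∈ I) {k : ℕ} (hk : (k.factorial : K) ≠ 0) {w : DiffPoly δ}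
    (hw : w ∈ I) (hdeg : (toPoly w).degree = k) : I = ⊤ := by
  induction k generalizing w with
  | zero =>
    obtain ⟨a, ha⟩ : ∃ a, w = const δ a := ⟨_, toPoly.injective (eq_C_of_degree_eq_zero hdeg)⟩
    have ha0 : a ≠ 0 := by
      rintro rfl
      simp [ha, const_zero] at hdeg
    rw [Ideal.eq_top_iff_one, ← const_one, ← inv_mul_cancel₀ ha0, const_mul, ← ha]
    exact I.mul_mem_left _ hw
  | succ k ih =>
    rw [Nat.factorial_succ, Nat.cast_mul] at hk
    exact ih (right_ne_zero_of_mul hk) (I.sub_mem (hI w hw) (I.mul_mem_left _ hw))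
      (degree_toPoly_commutator_const hc hdeg (left_ne_zero_of_mul hk))

end Commutator

section ArtinSchreier

variable {K : Type u} [Field K] {δ : Derivation ℤ K K} {p : ℕ}

variable (δ p) in
/-- The Artin–Schreier polynomial `t ^ p - t - d` in `K[t;δ]`. -/
noncomputable def artinSchreier (d : K) : DiffPoly δ := t δ ^ p - t δ - const δ d

theorem natDegree_artinSchreier (hp : 1 < p) (d : K) : natDegree (artinSchreier δ p d) = p := by
  rw [natDegree, artinSchreier, map_sub, map_sub, toPoly_t_pow, toPoly_t, toPoly_const, sub_sub,
    natDegree_sub_eq_left_of_natDegree_lt, natDegree_X_pow]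
  rwa [natDegree_X_pow, natDegree_X_add_C]

theorem artinSchreier_eq_sub_const (d : K) :
    artinSchreier δ p d = artinSchreier δ p 0 - const δ d := by
  rw [artinSchreier, artinSchreier, const_zero, sub_zero]

theorem artinSchreier_mul_t (d : K) :
    artinSchreier δ p d * t δ = t δ * artinSchreier δ p d + const δ (δ d) := by
  simp only [artinSchreier, sub_mul, mul_sub, t_mul_const δ d, pow_mul_comm' (t δ) p]
  abel

variable [Fact p.Prime] [CharP K p]

theorem shift_one_artinSchreier (d : K) :
    shift δ 1 (artinSchreier δ p d) = artinSchreier δ p d := by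
  simp only [artinSchreier, map_sub, map_pow, shift_t, shift_const, const_one]
  rw [add_pow_char_of_commute p (Commute.one_right (t δ)), one_pow]
  abel

theorem commute_artinSchreier_const (hδ : derivEnd δ ^ p = derivEnd δ) (d a : K) :
    Commute (artinSchreier δ p d) (const δ a) := by
  rw [commute_iff_eq]
  simp only [artinSchreier, sub_mul, mul_sub, t_mul_const, t_pow_char_mul_const, hδ,
    derivEnd_apply, (commute_const_const d a).eq]
  abel

theorem commute_artinSchreier_zero (hδ : derivEnd δ ^ p = derivEnd δ) (u : DiffPoly δ) :
    Commute (artinSchreier δ p 0) u :=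
  commute_of_commute_const_of_commute_t (commute_artinSchreier_const hδ 0)
    (by rw [commute_iff_eq, artinSchreier_mul_t, map_zero, const_zero, add_zero]) u

theorem mul_const_mem_of_artinSchreier_mem (hδ : derivEnd δ ^ p = derivEnd δ) {d : K}
    {I : Ideal (DiffPoly δ)} (hI : artinSchreier δ p d ∈ I) {v : DiffPoly δ} (hv : v ∈ I) :
    v * const δ d ∈ I := by
  have hmul : v * const δ d = artinSchreier δ p 0 * v - v * artinSchreier δ p d := by
    rw [(commute_artinSchreier_zero hδ v).eq, ← mul_sub, artinSchreier_eq_sub_const d,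
      sub_sub_cancel]
  exact hmul ▸ I.sub_mem (I.mul_mem_left _ hv) (I.mul_mem_left _ hI)

theorem isMaximal_span_artinSchreier (hδ : derivEnd δ ^ p = derivEnd δ) {d : K} (hd : δ d ≠ 0) :
    (Ideal.span {artinSchreier δ p d}).IsMaximal := by
  have hp : p.Prime := Fact.out
  have hnat := natDegree_artinSchreier (δ := δ) hp.one_lt d
  refine isMaximal_span_singleton (hp.pos.trans_eq hnat.symm) fun I hI w hw hw0 hdeg => ?_
  refine eq_top_of_forall_mul_const_mem hd (fun v => mul_const_mem_of_artinSchreier_mem hδ hI)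
    (k := natDegree w) ?_ hw (degree_toPoly hw0)
  rw [Ne, CharP.cast_eq_zero_iff K p, hp.dvd_factorial, not_le]
  exact hdeg.trans_eq hnat

end ArtinSchreier

end DiffPoly

theorem isNonassocDivision_of_noZeroDivisors (F : Type*) {A : Type u} [Field F] [NonAssocRing A]
    [Module F A] [IsScalarTower F A A] [SMulCommClass F A A] [FiniteDimensional F A]
    [Nontrivial A] [NoZeroDivisors A] : IsNonassocDivision A := by
  refine ⟨inferInstance, fun a ha => ⟨?_, ?_⟩⟩
  · have hinj : Function.Injective (LinearMap.mulLeft F a) :=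
      (injective_iff_map_eq_zero _).mpr fun x hx => (mul_eq_zero.mp hx).resolve_left ha
    exact ⟨hinj, LinearMap.injective_iff_surjective.mp hinj⟩
  · have hinj : Function.Injective (LinearMap.mulRight F a) :=
      (injective_iff_map_eq_zero _).mpr fun x hx => (mul_eq_zero.mp hx).resolve_right ha
    exact ⟨hinj, LinearMap.injective_iff_surjective.mp hinj⟩

namespace PetitAlgebra

open DiffPoly

section Basic

variable {K : Type u} [Field K] {δ : Derivation ℤ K K} {f : DiffPoly δ}

theorem mul_def (x y : PetitAlgebra f) : x * y = mk f (rep x * rep y) := rfl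

theorem rep_injective : Function.Injective (rep : PetitAlgebra f → DiffPoly δ) :=
  Subtype.val_injective

theorem rep_eq_zero {x : PetitAlgebra f} : rep x = 0 ↔ x = 0 :=
  map_eq_zero_iff rep rep_injective

theorem rep_mem (x : PetitAlgebra f) : rep x ∈ degLT δ f.natDegree := x.2

theorem rep_mk {u : DiffPoly δ} (hu : u ∈ degLT δ f.natDegree) : rep (mk f u) = u :=
  congrArg Subtype.val (modr_coe f ⟨u, hu⟩)

theorem exists_eq_mul_add_rep_mk (hf : f ≠ 0) (u : DiffPoly δ) :
    ∃ q, u = q * f + rep (mk f u) := modr_spec f u hf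

theorem mk_mul_self (hf : f ≠ 0) (q : DiffPoly δ) : mk f (q * f) = 0 := by
  obtain ⟨q', h⟩ := modr_spec f (q * f) hf
  exact rem_unique hf h (q' := q) (r' := 0) (by simp)

theorem mk_eq_zero_iff (hf : f ≠ 0) {u : DiffPoly δ} : mk f u = 0 ↔ u ∈ Ideal.span {f} := by
  rw [Ideal.mem_span_singleton']
  refine ⟨fun h => ?_, ?_⟩
  · obtain ⟨q, hq⟩ := exists_eq_mul_add_rep_mk hf u
    exact ⟨q, by rw [hq, h, map_zero, add_zero]⟩
  · rintro ⟨q, rfl⟩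
    exact mk_mul_self hf q

theorem mk_mul_rep_mk (hf : f ≠ 0) (u v : DiffPoly δ) :
    mk f (u * rep (mk f v)) = mk f (u * v) := by
  obtain ⟨q, hq⟩ := exists_eq_mul_add_rep_mk hf v
  conv_rhs => rw [hq, mul_add, ← mul_assoc, map_add, mk_mul_self hf, zero_add]

theorem rep_ofField (hf : 0 < f.natDegree) (a : K) : rep (ofField f a) = const δ a :=
  rep_mk (const_mem_degLT hf a)

theorem mem_range_ofField (hf : 0 < f.natDegree) {x : PetitAlgebra f} (hx : rep x ∈ degLT δ 1) :
    x ∈ Set.range (ofField f) := by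
  obtain ⟨a, ha⟩ := exists_const_eq_of_mem_degLT_one hx
  exact ⟨a, rep_injective (by rw [rep_ofField hf, ha])⟩

instance : IsScalarTower K (PetitAlgebra f) (PetitAlgebra f) where
  smul_assoc a x y := by
    rw [smul_eq_mul, smul_eq_mul, mul_def, mul_def, map_smul, smul_mul_assoc, map_smul]

instance : IsScalarTower (derivConst δ) (PetitAlgebra f) (PetitAlgebra f) where
  smul_assoc a x y := smul_assoc (a : K) x y

instance : SMulCommClass (derivConst δ) (PetitAlgebra f) (PetitAlgebra f) where
  smul_comm a x y := by
    change (a : K) • mk f (rep x * rep y) = mk f (rep x * rep ((a : K) • y))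
    rw [← map_smul, map_smul rep, smul_eq_const_mul, smul_eq_const_mul, ← mul_assoc, ← mul_assoc,
      (commute_const_of_mem_derivConst a.2 (rep x)).eq]

end Basic

section Dimension

variable {K : Type u} [Field K] {δ : Derivation ℤ K K} {f : DiffPoly δ}

instance (m : ℕ) : Module.Finite K (degLT δ m) := Module.Finite.equiv (degreeLTEquiv K m).symm

theorem finrank_degLT (m : ℕ) : Module.finrank K (degLT δ m) = m :=
  (degreeLTEquiv K m).finrank_eq.trans (Module.finrank_fin_fun K)

theorem finrank_eq_natDegree : Module.finrank K (PetitAlgebra f) = f.natDegree :=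
  finrank_degLT f.natDegree

theorem natDegree_le_of_span_pair_eq_top (hf : f ≠ 0) {q u : DiffPoly δ} (hq : q ≠ 0)
    (h : q * u ∈ Ideal.span {f}) (htop : Ideal.span {u, f} = ⊤) :
    f.natDegree ≤ q.natDegree := by
  let φ : degLT δ q.natDegree →ₗ[K] PetitAlgebra f :=
    mk f ∘ₗ LinearMap.mulRight K u ∘ₗ (degLT δ q.natDegree).subtype
  have hφ : Function.Surjective φ := by
    intro y
    have hy : rep y ∈ Ideal.span {u, f} := htop ▸ Submodule.mem_top
    obtain ⟨a, b, hab⟩ := Ideal.mem_span_pair.mp hy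
    obtain ⟨r, s, rfl⟩ := exists_rem q hq a
    refine ⟨r, ?_⟩
    rw [← mk_rep y, ← hab, add_mul, mul_assoc, map_add, map_add, mk_mul_self hf,
      (mk_eq_zero_iff hf).mpr (Ideal.mul_mem_left _ s h), zero_add, add_zero]
    rfl
  have hrank := LinearMap.finrank_le_finrank_of_surjective hφ
  rwa [finrank_eq_natDegree, finrank_degLT] at hrank

theorem noZeroDivisors_of_isMaximal (hf : f ≠ 0) (hmax : (Ideal.span {f}).IsMaximal) :
    NoZeroDivisors (PetitAlgebra f) where
  eq_zero_or_eq_zero_of_mul_eq_zero {x y} hxy := by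
    by_contra! hne
    have hx : rep x ≠ 0 := rep_eq_zero.not.mpr hne.1
    have hy : rep y ∉ Ideal.span {f} := by
      rw [← mk_eq_zero_iff hf, mk_rep]
      exact hne.2
    have htop : Ideal.span {rep y, f} = ⊤ := by
      refine hmax.out.2 _ (SetLike.lt_iff_le_and_exists.mpr
        ⟨Ideal.span_mono ?_, rep y, Ideal.subset_span ?_, hy⟩) <;> simp
    have hle := natDegree_le_of_span_pair_eq_top hf hx ((mk_eq_zero_iff hf).mp hxy) htop
    exact hle.not_gt (natDegree_lt_of_mem_degLT (rep_mem x) hx)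

end Dimension

section Nuclei

variable {K : Type u} [Field K] {δ : Derivation ℤ K K} {f : DiffPoly δ}

theorem associator_eq_neg_mk (hf : f ≠ 0) {x y z : PetitAlgebra f} {q : DiffPoly δ}
    (hq : rep x * rep y = q * f + rep (x * y)) :
    associator x y z = -mk f (q * f * rep z) := by
  have hright : x * (y * z) = mk f (rep x * rep y * rep z) := by
    rw [mul_def x, mul_def y, mk_mul_rep_mk hf, mul_assoc]
  rw [associator_apply, hright, hq, add_mul, map_add, ← mul_def, sub_add_cancel_right]

theorem associator_eq_zero_of_mul_rep_mem (hf : f ≠ 0) {x y : PetitAlgebra f}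
    (hxy : rep x * rep y ∈ degLT δ f.natDegree) (z : PetitAlgebra f) : associator x y z = 0 := by
  rw [associator_eq_neg_mk hf (q := 0) (by rw [mul_def, rep_mk hxy, zero_mul, zero_add]),
    zero_mul, zero_mul, map_zero, neg_zero]

theorem associator_eq_zero_of_commute (hf : f ≠ 0) (x y : PetitAlgebra f) {z : PetitAlgebra f}
    (hz : Commute f (rep z)) : associator x y z = 0 := by
  obtain ⟨q, hq⟩ := exists_eq_mul_add_rep_mk hf (rep x * rep y)
  rw [associator_eq_neg_mk hf hq, mul_assoc, hz.eq, ← mul_assoc, mk_mul_self hf, neg_zero]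

theorem mul_rep_mem_of_associator_eq_zero (hf : f ≠ 0) {x y z : PetitAlgebra f} {v : DiffPoly δ}
    {c : K} (hc : c ≠ 0) (hz : f * rep z = v * f + const δ c) (h : associator x y z = 0) :
    rep x * rep y ∈ degLT δ f.natDegree := by
  obtain ⟨q, hq⟩ := exists_eq_mul_add_rep_mk hf (rep x * rep y)
  have hqdeg : q ∈ degLT δ f.natDegree := by
    rw [← mul_mem_degLT_add_natDegree_iff hf, eq_sub_of_add_eq hq.symm]
    exact Submodule.sub_mem _ (mul_mem_degLT (rep_mem x) (rep_mem y))
      (degLT_mono (Nat.le_add_left _ _) (rep_mem _))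
  have hqc : q * const δ c = 0 := by
    rw [← rep_mk (mul_const_mem_degLT hqdeg c), rep_eq_zero, ← neg_eq_zero, ← h,
      associator_eq_neg_mk hf hq, mul_assoc, hz, mul_add, ← mul_assoc, map_add, mk_mul_self hf,
      zero_add]
  have hq0 : q = 0 := (mul_eq_zero.mp hqc).resolve_right (const_eq_zero.not.mpr hc)
  rw [hq, hq0, zero_mul, zero_add]
  exact rep_mem _

theorem range_ofField_subset_leftNucleus (hf : 0 < f.natDegree) :
    Set.range (ofField f) ⊆ leftNucleus (PetitAlgebra f) := by
  rintro _ ⟨a, rfl⟩ y z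
  refine associator_eq_zero_of_mul_rep_mem (ne_zero_of_natDegree_pos hf) ?_ z
  rw [rep_ofField hf, mul_mem_degLT_comm]
  exact mul_const_mem_degLT (rep_mem y) a

theorem range_ofField_subset_middleNucleus (hf : 0 < f.natDegree) :
    Set.range (ofField f) ⊆ middleNucleus (PetitAlgebra f) := by
  rintro _ ⟨a, rfl⟩ y z
  refine associator_eq_zero_of_mul_rep_mem (ne_zero_of_natDegree_pos hf) ?_ z
  rw [rep_ofField hf]
  exact mul_const_mem_degLT (rep_mem y) a

theorem range_ofField_subset_rightNucleus (hf : 0 < f.natDegree)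
    (hcomm : ∀ a, Commute f (const δ a)) :
    Set.range (ofField f) ⊆ rightNucleus (PetitAlgebra f) := by
  rintro _ ⟨a, rfl⟩ y z
  refine associator_eq_zero_of_commute (ne_zero_of_natDegree_pos hf) y z ?_
  rw [rep_ofField hf]
  exact hcomm a

theorem rep_mk_t_pow {n : ℕ} (hn : n < f.natDegree) : rep (mk f (t δ ^ n)) = t δ ^ n :=
  rep_mk (t_pow_mem_degLT_iff.mpr hn)

theorem rep_mk_t (hf : 1 < f.natDegree) : rep (mk f (t δ)) = t δ := by
  simpa only [pow_one] using rep_mk_t_pow hf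

theorem mem_degLT_one_of_mul_t_pow_mem {n : ℕ} (hn : 0 < n) {u : DiffPoly δ}
    (h : u * t δ ^ (n - 1) ∈ degLT δ n) : u ∈ degLT δ 1 := by
  have ht : t δ ^ (n - 1) ≠ 0 := pow_ne_zero _ (toPoly_eq_zero.not.mp X_ne_zero)
  rwa [← mul_mem_degLT_add_natDegree_iff ht, DiffPoly.natDegree, toPoly_t_pow, natDegree_X_pow,
    Nat.add_sub_cancel' hn]

variable {c : K}

theorem mul_rep_mem_of_associator_mk_t_eq_zero (hf : 1 < f.natDegree) (hc : c ≠ 0)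
    (ht : f * t δ = t δ * f + const δ c) {x y : PetitAlgebra f}
    (h : associator x y (mk f (t δ)) = 0) : rep x * rep y ∈ degLT δ f.natDegree :=
  mul_rep_mem_of_associator_eq_zero (ne_zero_of_natDegree_pos (pos_of_gt hf)) hc
    (by rw [rep_mk_t hf, ht]) h

theorem leftNucleus_eq_range_ofField (hf : 1 < f.natDegree) (hc : c ≠ 0)
    (ht : f * t δ = t δ * f + const δ c) :
    leftNucleus (PetitAlgebra f) = Set.range (ofField f) := by
  have hpos : 0 < f.natDegree := pos_of_gt hf
  refine Set.Subset.antisymm (fun x hx => mem_range_ofField hpos ?_)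
    (range_ofField_subset_leftNucleus hpos)
  have hmem := mul_rep_mem_of_associator_mk_t_eq_zero hf hc ht
    (hx (mk f (t δ ^ (f.natDegree - 1))) _)
  rw [rep_mk_t_pow (Nat.sub_one_lt_of_lt hpos)] at hmem
  exact mem_degLT_one_of_mul_t_pow_mem hpos hmem

theorem middleNucleus_eq_range_ofField (hf : 1 < f.natDegree) (hc : c ≠ 0)
    (ht : f * t δ = t δ * f + const δ c) :
    middleNucleus (PetitAlgebra f) = Set.range (ofField f) := by
  have hpos : 0 < f.natDegree := pos_of_gt hf
  refine Set.Subset.antisymm (fun x hx => mem_range_ofField hpos ?_)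
    (range_ofField_subset_middleNucleus hpos)
  have hmem := mul_rep_mem_of_associator_mk_t_eq_zero hf hc ht
    (hx (mk f (t δ ^ (f.natDegree - 1))) _)
  rw [rep_mk_t_pow (Nat.sub_one_lt_of_lt hpos), mul_mem_degLT_comm] at hmem
  exact mem_degLT_one_of_mul_t_pow_mem hpos hmem

theorem exists_mul_mul_ne (hf : 1 < f.natDegree) (hc : c ≠ 0)
    (ht : f * t δ = t δ * f + const δ c) :
    ∃ x y z : PetitAlgebra f, (x * y) * z ≠ x * (y * z) := by
  have hpos : 0 < f.natDegree := pos_of_gt hf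
  refine ⟨mk f (t δ ^ (f.natDegree - 1)), mk f (t δ), mk f (t δ), fun h => ?_⟩
  have hmem := mul_rep_mem_of_associator_mk_t_eq_zero hf hc ht (sub_eq_zero.mpr h)
  rw [rep_mk_t_pow (Nat.sub_one_lt_of_lt hpos), rep_mk_t hf, ← pow_succ,
    Nat.sub_add_cancel hpos, t_pow_mem_degLT_iff] at hmem
  exact hmem.false

end Nuclei

section Shift

variable {K : Type u} [Field K] {δ : Derivation ℤ K K} {f : DiffPoly δ}

variable (f) in
/-- The `Const(δ)`-linear bijection of `S_f` given by the substitution `t ↦ t + c` on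
representatives; it is multiplicative when the substitution fixes `f`. -/
noncomputable def shiftEquiv (c : K) : PetitAlgebra f ≃ₗ[derivConst δ] PetitAlgebra f where
  toFun x := ⟨shift δ c (rep x), shift_mem_degLT c (rep_mem x)⟩
  map_add' x y := rep_injective (map_add (shift δ c) (rep x) (rep y))
  map_smul' a x := rep_injective (shift_smul c (a : K) (rep x))
  invFun x := ⟨shift δ (-c) (rep x), shift_mem_degLT (-c) (rep_mem x)⟩
  left_inv x := rep_injective <|
    (shift_shift (-c) c (rep x)).trans (by rw [neg_add_cancel, shift_zero])
  right_inv x := rep_injective <|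
    (shift_shift c (-c) (rep x)).trans (by rw [add_neg_cancel, shift_zero])

theorem rep_shiftEquiv (c : K) (x : PetitAlgebra f) :
    rep (shiftEquiv f c x) = shift δ c (rep x) := rfl

theorem shiftEquiv_zero : shiftEquiv f 0 = 1 :=
  LinearEquiv.ext fun x => rep_injective (shift_zero (rep x))

theorem shiftEquiv_mul (b c : K) : shiftEquiv f b * shiftEquiv f c = shiftEquiv f (b + c) :=
  LinearEquiv.ext fun x => rep_injective (shift_shift b c (rep x))

theorem shiftEquiv_pow (c : K) (n : ℕ) : shiftEquiv f c ^ n = shiftEquiv f (n * c) := by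
  induction n with
  | zero => rw [pow_zero, Nat.cast_zero, zero_mul, shiftEquiv_zero]
  | succ n ih => rw [pow_succ, ih, shiftEquiv_mul, Nat.cast_succ, add_mul, one_mul]

theorem shiftEquiv_ofField (hf : 0 < f.natDegree) (c a : K) :
    shiftEquiv f c (ofField f a) = ofField f a :=
  rep_injective (by rw [rep_shiftEquiv, rep_ofField hf, shift_const])

theorem shiftEquiv_mem_nonassocAut (hf : f ≠ 0) {c : K} (hc : shift δ c f = f) :
    shiftEquiv f c ∈ nonassocAut (derivConst δ) (PetitAlgebra f) := fun x y => by
  obtain ⟨q, hq⟩ := exists_eq_mul_add_rep_mk hf (rep x * rep y)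
  have hshift : shift δ c (rep x) * shift δ c (rep y) =
      shift δ c q * f + rep (shiftEquiv f c (x * y)) := by
    rw [rep_shiftEquiv, ← map_mul, hq, map_add, map_mul, hc, mul_def]
  rw [mul_def (shiftEquiv f c x), rep_shiftEquiv, rep_shiftEquiv, hshift, map_add,
    mk_mul_self hf, zero_add, mk_rep]

theorem orderOf_shiftEquiv_one (p : ℕ) [Fact p.Prime] [CharP K p] (hf : 1 < f.natDegree) :
    orderOf (shiftEquiv f 1) = p := by
  refine orderOf_eq_prime ?_ fun h => ?_
  · rw [shiftEquiv_pow, CharP.cast_eq_zero, zero_mul, shiftEquiv_zero]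
  · have ht : shift δ 1 (rep (mk f (t δ))) = rep (mk f (t δ)) :=
      congrArg rep (LinearEquiv.congr_fun h (mk f (t δ)))
    rw [rep_mk_t hf, shift_t, add_eq_left, const_one] at ht
    exact one_ne_zero ht

theorem exists_isCyclic_subgroup_nonassocAut (p : ℕ) [Fact p.Prime] [CharP K p]
    (hf : 1 < f.natDegree) (hshift : shift δ 1 f = f) :
    ∃ G : Subgroup (nonassocAut (derivConst δ) (PetitAlgebra f)),
      IsCyclic G ∧ Nat.card G = p ∧
      ∀ φ ∈ G, ∀ a : K, (φ : PetitAlgebra f ≃ₗ[derivConst δ] PetitAlgebra f) (ofField f a) =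
        ofField f a := by
  have hpos : 0 < f.natDegree := pos_of_gt hf
  let σ : nonassocAut (derivConst δ) (PetitAlgebra f) :=
    ⟨shiftEquiv f 1, shiftEquiv_mem_nonassocAut (ne_zero_of_natDegree_pos hpos) hshift⟩
  have hσ : σ ∈ fixingSubgroup _ (Set.range (ofField f)) := by
    rw [mem_fixingSubgroup_iff]
    rintro _ ⟨a, rfl⟩
    exact shiftEquiv_ofField hpos 1 a
  refine ⟨Subgroup.zpowers σ, inferInstance, ?_, fun φ hφ a => ?_⟩
  · rw [Nat.card_zpowers, ← Subgroup.orderOf_coe]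
    exact orderOf_shiftEquiv_one p hf
  · have hfix := (mem_fixingSubgroup_iff _).mp (Subgroup.zpowers_le.mpr hσ hφ)
    exact hfix _ (Set.mem_range_self a)

end Shift

section ArtinSchreier

variable {K : Type u} [Field K] {δ : Derivation ℤ K K} {p : ℕ} [Fact p.Prime] [CharP K p] {d : K}

theorem finrank_artinSchreier (hδ : derivEnd δ ^ p = derivEnd δ) (hd : δ d ≠ 0) :
    Module.finrank (derivConst δ) (PetitAlgebra (artinSchreier δ p d)) = p ^ 2 := by
  rw [← Module.finrank_mul_finrank (derivConst δ) K, finrank_eq_natDegree,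
    natDegree_artinSchreier (Fact.out : p.Prime).one_lt, derivEnd.finrank_derivConst p hδ hd, sq]

theorem isNonassocDivision_artinSchreier (hδ : derivEnd δ ^ p = derivEnd δ) (hd : δ d ≠ 0) :
    IsNonassocDivision (PetitAlgebra (artinSchreier δ p d)) := by
  have hp : p.Prime := Fact.out
  have hrank : 0 < Module.finrank (derivConst δ) (PetitAlgebra (artinSchreier δ p d)) :=
    (pow_pos hp.pos 2).trans_eq (finrank_artinSchreier hδ hd).symm
  have hf : artinSchreier δ p d ≠ 0 := ne_zero_of_natDegree_pos
    (hp.pos.trans_eq (natDegree_artinSchreier hp.one_lt d).symm)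
  have := Module.finite_of_finrank_pos hrank
  have := Module.nontrivial_of_finrank_pos hrank
  have := noZeroDivisors_of_isMaximal hf (isMaximal_span_artinSchreier hδ hd)
  exact isNonassocDivision_of_noZeroDivisors (derivConst δ)

end ArtinSchreier

end PetitAlgebra

theorem mainTheorem1 {K : Type u} [Field K] (p : ℕ) [Fact p.Prime] [CharP K p]
    (δ : Derivation ℤ K K)
    (hδ : minpoly (derivConst δ) (derivEnd δ) = (X ^ p - X : (derivConst δ)[X]))
    (d : K) (hd : d ∉ derivConst δ)
    (f : DiffPoly δ) (hf : f = DiffPoly.t δ ^ p - DiffPoly.t δ - DiffPoly.const δ d) :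
    -- the multiplication of the unital ring `S_f` is bilinear over `F = Const(δ)`
    IsScalarTower (derivConst δ) (PetitAlgebra f) (PetitAlgebra f) ∧
    SMulCommClass (derivConst δ) (PetitAlgebra f) (PetitAlgebra f) ∧
    -- `S_f` is a division algebra of dimension `p ^ 2` that is not associative
    IsNonassocDivision (PetitAlgebra f) ∧
    (∃ x y z : PetitAlgebra f, (x * y) * z ≠ x * (y * z)) ∧
    Module.finrank (derivConst δ) (PetitAlgebra f) = p ^ 2 ∧
    -- the nuclei
    leftNucleus (PetitAlgebra f) = Set.range (PetitAlgebra.ofField f) ∧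
    middleNucleus (PetitAlgebra f) = Set.range (PetitAlgebra.ofField f) ∧
    Set.range (PetitAlgebra.ofField f) ⊆ rightNucleus (PetitAlgebra f) ∧
    -- a cyclic group of order `p` of `F`-algebra automorphisms that fix `K` elementwise
    ∃ G : Subgroup (nonassocAut (derivConst δ) (PetitAlgebra f)),
      IsCyclic G ∧ Nat.card G = p ∧
      ∀ φ ∈ G, ∀ a : K, (φ : PetitAlgebra f ≃ₗ[derivConst δ] PetitAlgebra f)
        (PetitAlgebra.ofField f a) = PetitAlgebra.ofField f a := by
  obtain rfl : f = DiffPoly.artinSchreier δ p d := hf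
  have hpow : derivEnd δ ^ p = derivEnd δ := by
    have haeval := minpoly.aeval (derivConst δ) (derivEnd δ)
    rwa [hδ, map_sub, map_pow, aeval_X, sub_eq_zero] at haeval
  have hδd : δ d ≠ 0 := hd
  have hp : 1 < p := (Fact.out : p.Prime).one_lt
  have hdeg : 1 < (DiffPoly.artinSchreier δ p d).natDegree :=
    hp.trans_eq (DiffPoly.natDegree_artinSchreier hp d).symm
  have ht := DiffPoly.artinSchreier_mul_t (δ := δ) (p := p) d
  exact ⟨inferInstance, inferInstance,
    PetitAlgebra.isNonassocDivision_artinSchreier hpow hδd,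
    PetitAlgebra.exists_mul_mul_ne hdeg hδd ht,
    PetitAlgebra.finrank_artinSchreier hpow hδd,
    PetitAlgebra.leftNucleus_eq_range_ofField hdeg hδd ht,
    PetitAlgebra.middleNucleus_eq_range_ofField hdeg hδd ht,
    PetitAlgebra.range_ofField_subset_rightNucleus (pos_of_gt hdeg)
      (DiffPoly.commute_artinSchreier_const hpow d),
    PetitAlgebra.exists_isCyclic_subgroup_nonassocAut p hdeg
      (DiffPoly.shift_one_artinSchreier d)⟩
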